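/- Let $(\mathcal K,\otimes,\mathbb 1,\Sigma)$ be a tensor-triangulated category (a triangulated category with a compatible symmetric monoidal structure, exact in each variable, with the usual Koszul sign) and let $B\in\mathcal K$ be a rigid (strongly dualizable) object with dual $B^\vee$; for instance $B$ may be any object if $\mathcal K$ is rigid. Let $F_B\xrightarrow{\xi_B}\mathbb 1\xrightarrow{\mathrm{coev}}B\otimes B^\vee\to\Sigma F_B$ be a distinguished triangle. Notation. $\operatorname{add}(B\otimes\mathcal K)$ is the closure of $\{B\otimes W : W\in\mathcal K\}$ under finite sums and direct summands. $\pi\colon\mathcal K\to\mathcal S=\mathcal K/\operatorname{add}(B\otimes\mathcal K)$ is the additive quotient: same objects, and morphisms of $\mathcal K$ modulo those factoring via an object of $\operatorname{add}(B\otimes\mathcal K)$; $\mathcal S$ carries the induced tensor product, and $\underline\Sigma\colon\mathcal S\to\mathcal S$ is the functor induced by $\Sigma$. Let $\mathscr E_B$ be the class of distinguished triangles $X\to Y\to Z\xrightarrow{h}\Sigma X$ with $B\otimes h=0$; an object $I$ is $\mathscr E_B$-injective if $0\to\mathcal K(Z,I)\to\mathcal K(Y,I)\to\mathcal K(X,I)\to0$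 is exact for every such triangle. Choose for each $X$ a triangle $X\xrightarrow{i_X}X_{\mathscr E}\xrightarrow{p_X}X'\xrightarrow{\alpha_X}\Sigma X$ in $\mathscr E_B$ with $X_{\mathscr E}$ an $\mathscr E_B$-injective object. The suspension $\Sigma_B\colon\mathcal S\to\mathcal S$ is given by $\Sigma_B\pi(X)=\pi(X')$ and, for $f\colon X\to Y$, $\Sigma_B\pi(f)=\pi(f')$ where $f'\colon X'\to Y'$ is part of a morphism of triangles extending $f$. The comparison morphism $\underline\alpha\colon\Sigma_B\to\underline\Sigma$ has components $\pi(\alpha_X)$. The distinguished triangles of $\mathcal S$ are those isomorphic to $X\xrightarrow{\pi f}Y\xrightarrow{\pi g}Z\xrightarrow{\pi h}\Sigma_BX$, where $Z$ is a homotopy pushout of $f$ and $i_X$, with maps $g\colon Y\to Z$ and $k\colon X_{\mathscr E}\to Z$, and $h\colon Z\to X'$ is such that $(f,k,\mathrm{id}_{X'},\Sigma f)$ is a morphism from the chosen triangle of $X$ to a distinguished triangle $Y\xrightarrow{g}Z\xrightarrow{h}X'\to\Sigma Y$. Theorem. (a) The object $\pi(F_B)$ is $\otimes$-invertible in $\mathcal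 S$. Moreover, for every choice of the triangles above there is a natural isomorphism $\varphi\colon\Sigma_B(-)\xrightarrow{\sim}\pi(F_B)\otimes\underline\Sigma(-)$ with the following two properties. (b) Under $\varphi$, the morphism $\pi(\xi_B)\otimes\underline\Sigma$ is the comparison morphism: $(\pi(\xi_B)\otimes\underline\Sigma)\circ\varphi=\underline\alpha$, where $\mathbb 1\otimes\underline\Sigma$ is identified with $\underline\Sigma$. (c) For every $f\colon X\to Y$ in $\mathcal K$ and every distinguished triangle $$F_B\otimes X\xrightarrow{\ \xi_B\otimes f\ }Y\xrightarrow{\ g\ }Z\xrightarrow{\ h\ }\Sigma(F_B\otimes X)$$ in $\mathcal K$, the triangle $$X\xrightarrow{\ \pi(f)\ }Y\xrightarrow{\ \pi(g)\ }Z\xrightarrow{\ -\varphi_X^{-1}\circ\pi(e\circ h)\ }\Sigma_BX$$ is distinguished in $\mathcal S$, where $e\colon\Sigma(F_B\otimes X)\cong F_B\otimes\Sigma X$ is the canonical isomorphism. In particular the cone of $\pi(f)$ is $\pi(\operatorname{cone}(\xi_B\otimes f))$. (In other words, $\pi(f),\pi(g),\pi(h)$ form a distinguished triangle when $\pi(\Sigma(F_B\otimes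 X))$ is identified with $\Sigma_BX$ through $-\varphi_X$ and $e$.) -/

import Mathlib

open CategoryTheory CategoryTheory.Limits CategoryTheory.Pretriangulated
open CategoryTheory.MonoidalCategory (tensorLeft tensorRight)
open scoped MonoidalCategory ZeroObject

set_option linter.unusedSectionVars false

universe v u

/-- A tensor-triangulated structure: a symmetric monoidal structure (biadditive, by
`MonoidalPreadditive`) on a triangulated category together with natural isomorphisms
`ΣX ⊗ Y ≅ Σ(X ⊗ Y)`, compatible with the unit and the associator, for which tensoring preserves
distinguished triangles, and such that the two induced isomorphisms `ΣX ⊗ ΣY ≅ Σ²(X ⊗ Y)` agree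
up to the sign `-1`. The isomorphism `X ⊗ ΣY ≅ Σ(X ⊗ Y)` is obtained by means of the symmetry, so
that exactness of `- ⊗ W` is also exactness of `W ⊗ -`. -/
class TensorTriangulated (C : Type u) [Category.{v} C] [HasZeroObject C] [HasShift C ℤ]
    [Preadditive C] [∀ n : ℤ, (shiftFunctor C n).Additive] [Pretriangulated C]
    [MonoidalCategory C] [SymmetricCategory C] [MonoidalPreadditive C] where
  /-- the isomorphism `ΣX ⊗ Y ≅ Σ(X ⊗ Y)` -/
  shiftTensor (X Y : C) : (X⟦(1 : ℤ)⟧ ⊗ Y : C) ≅ (X ⊗ Y : C)⟦(1 : ℤ)⟧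
  naturality_left {X X' : C} (f : X ⟶ X') (Y : C) :
    f⟦(1 : ℤ)⟧' ▷ Y ≫ (shiftTensor X' Y).hom = (shiftTensor X Y).hom ≫ (f ▷ Y)⟦(1 : ℤ)⟧'
  naturality_right (X : C) {Y Y' : C} (f : Y ⟶ Y') :
    X⟦(1 : ℤ)⟧ ◁ f ≫ (shiftTensor X Y').hom = (shiftTensor X Y).hom ≫ (X ◁ f)⟦(1 : ℤ)⟧'
  unit (X : C) :
    (shiftTensor X (𝟙_ C)).hom ≫ (ρ_ X).hom⟦(1 : ℤ)⟧' = (ρ_ (X⟦(1 : ℤ)⟧)).hom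
  assoc (X Y Z : C) :
    (shiftTensor X Y).hom ▷ Z ≫ (shiftTensor (X ⊗ Y) Z).hom ≫ (α_ X Y Z).hom⟦(1 : ℤ)⟧' =
      (α_ (X⟦(1 : ℤ)⟧) Y Z).hom ≫ (shiftTensor X (Y ⊗ Z)).hom
  distinguished (T : Triangle C) (hT : T ∈ distTriang C) (W : C) :
    Triangle.mk (T.mor₁ ▷ W) (T.mor₂ ▷ W) (T.mor₃ ▷ W ≫ (shiftTensor T.obj₁ W).hom) ∈ distTriang C
  koszul (X Y : C) :
    (shiftTensor X (Y⟦(1 : ℤ)⟧)).hom ≫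
        ((β_ X (Y⟦(1 : ℤ)⟧)).hom ≫ (shiftTensor Y X).hom ≫ (β_ Y X).hom⟦(1 : ℤ)⟧')⟦(1 : ℤ)⟧' =
      -(((β_ (X⟦(1 : ℤ)⟧) (Y⟦(1 : ℤ)⟧)).hom ≫ (shiftTensor Y (X⟦(1 : ℤ)⟧)).hom ≫
          (β_ Y (X⟦(1 : ℤ)⟧)).hom⟦(1 : ℤ)⟧') ≫ (shiftTensor X Y).hom⟦(1 : ℤ)⟧')

namespace RelStable

/-- `AddClosure P` is `add(P)`: the closure of the class of objects `P` under finite direct sums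
and direct summands (in particular under isomorphisms). -/
inductive AddClosure {C : Type u} [Category.{v} C] [Preadditive C] [HasZeroObject C]
    [HasBinaryBiproducts C] (P : C → Prop) : C → Prop
  | of {X : C} : P X → AddClosure P X
  | zero {X : C} : IsZero X → AddClosure P X
  | sum {X Y : C} : AddClosure P X → AddClosure P Y → AddClosure P (X ⊞ Y)
  | summand {X Y : C} : Retract X Y → AddClosure P Y → AddClosure P X

section

variable {C : Type u} [Category.{v} C] [HasZeroObject C] [HasShift C ℤ]
    [Preadditive C] [∀ n : ℤ, (shiftFunctor C n).Additive] [Pretriangulated C]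
    [MonoidalCategory C] [SymmetricCategory C] [MonoidalPreadditive C]

/-- The isomorphism `X ⊗ ΣY ≅ Σ(X ⊗ Y)` obtained from `ΣY ⊗ X ≅ Σ(Y ⊗ X)` by symmetry. -/
def tensorShift [TensorTriangulated C] (X Y : C) :
    (X ⊗ Y⟦(1 : ℤ)⟧ : C) ≅ (X ⊗ Y : C)⟦(1 : ℤ)⟧ :=
  β_ X (Y⟦(1 : ℤ)⟧) ≪≫ TensorTriangulated.shiftTensor Y X ≪≫
    (shiftFunctor C (1 : ℤ)).mapIso (β_ Y X)

/-- Membership in `add(B ⊗ K)`. -/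
def AddTensor (B : C) : C → Prop := AddClosure (fun X => ∃ W : C, X = (B ⊗ W : C))


lemma AddTensor.exists_retract {B P : C} (h : AddTensor B P) :
    ∃ W : C, Nonempty (Retract P (B ⊗ W : C)) := by
  induction h with
  | of h => obtain ⟨W, rfl⟩ := h; exact ⟨W, ⟨Retract.refl _⟩⟩
  | zero h => exact ⟨0, ⟨⟨0, 0, h.eq_of_src _ _⟩⟩⟩
  | summand r _ ih => obtain ⟨W, ⟨r'⟩⟩ := ih; exact ⟨W, ⟨r.trans r'⟩⟩
  | sum _ _ ih₁ ih₂ =>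
    obtain ⟨W₁, ⟨r₁⟩⟩ := ih₁
    obtain ⟨W₂, ⟨r₂⟩⟩ := ih₂
    refine ⟨W₁ ⊞ W₂, ⟨⟨biprod.desc (r₁.i ≫ B ◁ biprod.inl) (r₂.i ≫ B ◁ biprod.inr),
      biprod.lift (B ◁ biprod.fst ≫ r₁.r) (B ◁ biprod.snd ≫ r₂.r), ?_⟩⟩⟩
    have e (X Y Z : C) (f : X ⟶ Y) (g : Y ⟶ Z) : B ◁ f ≫ B ◁ g = B ◁ (f ≫ g) := by simp
    apply biprod.hom_ext' <;> apply biprod.hom_ext <;>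
      simp [reassoc_of% e]

lemma AddTensor.of_retract {B P W : C} (r : Retract P (B ⊗ W : C)) : AddTensor B P :=
  .summand r (.of ⟨W, rfl⟩)

lemma AddTensor.tensor_right {B P : C} (h : AddTensor B P) (Z : C) :
    AddTensor B (P ⊗ Z : C) := by
  obtain ⟨W, ⟨r⟩⟩ := h.exists_retract
  exact .of_retract ((r.map (tensorRight Z)).trans (Retract.ofIso (α_ B W Z)))

lemma AddTensor.tensor_left {B P : C} (h : AddTensor B P) (Z : C) :
    AddTensor B (Z ⊗ P : C) :=
  .summand (Retract.ofIso (β_ Z P)) (h.tensor_right Z)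

lemma AddTensor.shift [TensorTriangulated C] {B P : C} (h : AddTensor B P) :
    AddTensor B (P⟦(1 : ℤ)⟧) := by
  obtain ⟨W, ⟨r⟩⟩ := h.exists_retract
  exact .of_retract ((r.map (shiftFunctor C (1 : ℤ))).trans (Retract.ofIso (tensorShift B W).symm))

/-- Two parallel morphisms are identified in `K / add(B ⊗ K)` when their difference factors via
an object of `add(B ⊗ K)`. -/
def stableRel (B : C) : HomRel C := fun X Y f g =>
  ∃ P : C, AddTensor B P ∧ ∃ (a : X ⟶ P) (b : P ⟶ Y), f - g = a ≫ b

lemma stableRel_add {B X Y : C} (f₁ f₂ g₁ g₂ : X ⟶ Y) (hf : stableRel B f₁ f₂)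
    (hg : stableRel B g₁ g₂) : stableRel B (f₁ + g₁) (f₂ + g₂) := by
  obtain ⟨P, hP, a, b, h⟩ := hf
  obtain ⟨Q, hQ, c, d, h'⟩ := hg
  exact ⟨P ⊞ Q, .sum hP hQ, biprod.lift a c, biprod.desc b d, by
    rw [biprod.lift_desc, ← h, ← h']; abel⟩

instance (B : C) : Congruence (stableRel B) where
  equivalence := fun {X Y} =>
    { refl := fun f => ⟨0, .zero (isZero_zero C), 0, 0, by simp⟩
      symm := by
        rintro f g ⟨P, hP, a, b, h⟩
        exact ⟨P, hP, -a, b, by rw [Preadditive.neg_comp, ← h, neg_sub]⟩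
      trans := by
        rintro f g k hfg hgk
        obtain ⟨P, hP, a, b, h⟩ := stableRel_add _ _ _ _ hfg hgk
        exact ⟨P, hP, a, b, by rw [← h]; abel⟩ }
  comp_left := by
    rintro X Y Z f g g' ⟨P, hP, a, b, h⟩
    exact ⟨P, hP, f ≫ a, b, by rw [← Preadditive.comp_sub, h, Category.assoc]⟩
  comp_right := by
    rintro X Y Z f f' g ⟨P, hP, a, b, h⟩
    exact ⟨P, hP, a, b ≫ g, by rw [← Preadditive.sub_comp, h, Category.assoc]⟩

/-- The relative stable category `K / add(B ⊗ K)`: the objects are those of `K`, the morphisms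
are those of `K` modulo the ones that factor via an object of `add(B ⊗ K)`. -/
abbrev StableCat (B : C) := CategoryTheory.Quotient (stableRel B)

/-- The quotient functor `π : K ⥤ K / add(B ⊗ K)`. -/
abbrev stab (B : C) : C ⥤ StableCat B := CategoryTheory.Quotient.functor (stableRel B)

instance (B : C) : Preadditive (StableCat B) :=
  CategoryTheory.Quotient.preadditive (stableRel B) (fun _ _ => stableRel_add)

lemma stableRel_whiskerLeft {B X Y : C} (Z : C) {f g : X ⟶ Y} (h : stableRel B f g) :
    stableRel B (Z ◁ f) (Z ◁ g) := by
  obtain ⟨P, hP, a, b, h⟩ := h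
  refine ⟨_, hP.tensor_left Z, Z ◁ a, Z ◁ b, ?_⟩
  rw [← MonoidalCategory.whiskerLeft_comp, ← h]
  exact ((tensorLeft Z).map_sub).symm

lemma stableRel_whiskerRight {B X Y : C} (Z : C) {f g : X ⟶ Y} (h : stableRel B f g) :
    stableRel B (f ▷ Z) (g ▷ Z) := by
  obtain ⟨P, hP, a, b, h⟩ := h
  refine ⟨_, hP.tensor_right Z, a ▷ Z, b ▷ Z, ?_⟩
  rw [← MonoidalCategory.comp_whiskerRight, ← h]
  exact ((tensorRight Z).map_sub).symm

/-- `Z ⊗ -` on `K / add(B ⊗ K)`, induced by the one of `K`. -/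
def stableTensorLeft (B Z : C) : StableCat B ⥤ StableCat B :=
  CategoryTheory.Quotient.lift _ (tensorLeft Z ⋙ stab B) (fun _ _ _ _ h =>
    CategoryTheory.Quotient.sound _ (stableRel_whiskerLeft Z h))

/-- `- ⊗ Z` on `K / add(B ⊗ K)`, induced by the one of `K`. -/
def stableTensorRight (B Z : C) : StableCat B ⥤ StableCat B :=
  CategoryTheory.Quotient.lift _ (tensorRight Z ⋙ stab B) (fun _ _ _ _ h =>
    CategoryTheory.Quotient.sound _ (stableRel_whiskerRight Z h))

/-- The tensor product of `K / add(B ⊗ K)` is the one of `K`, on objects and on morphisms. -/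
instance (B : C) : MonoidalCategoryStruct (StableCat B) where
  tensorObj X Y := (stab B).obj (X.as ⊗ Y.as)
  whiskerLeft X _ _ f := (stableTensorLeft B X.as).map f
  whiskerRight f Y := (stableTensorRight B Y.as).map f
  tensorUnit := (stab B).obj (𝟙_ C)
  associator X Y Z := (stab B).mapIso (α_ X.as Y.as Z.as)
  leftUnitor X := (stab B).mapIso (λ_ X.as)
  rightUnitor X := (stab B).mapIso (ρ_ X.as)

instance (B : C) : MonoidalCategory (StableCat B) where
  tensorHom_def _ _ := rfl
  id_tensorHom_id X Y := congr_arg (stab B).map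
    (by simp : 𝟙 X.as ▷ Y.as ≫ X.as ◁ 𝟙 Y.as = 𝟙 (X.as ⊗ Y.as : C))
  tensorHom_comp_tensorHom := by
    rintro _ _ _ _ _ _ ⟨f₁⟩ ⟨f₂⟩ ⟨g₁⟩ ⟨g₂⟩
    exact congr_arg (stab B).map (by simp [MonoidalCategory.whisker_exchange_assoc])
  whiskerLeft_id X Y := congr_arg (stab B).map
    (MonoidalCategory.whiskerLeft_id X.as Y.as)
  id_whiskerRight X Y := congr_arg (stab B).map
    (MonoidalCategory.id_whiskerRight X.as Y.as)
  associator_naturality := by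
    rintro _ _ _ _ _ _ ⟨f₁⟩ ⟨f₂⟩ ⟨f₃⟩
    have e := MonoidalCategory.associator_naturality f₁ f₂ f₃
    simp only [MonoidalCategory.tensorHom_def] at e
    exact congr_arg (stab B).map e
  leftUnitor_naturality := by
    rintro _ _ ⟨f⟩
    exact congr_arg (stab B).map (MonoidalCategory.leftUnitor_naturality f)
  rightUnitor_naturality := by
    rintro _ _ ⟨f⟩
    exact congr_arg (stab B).map (MonoidalCategory.rightUnitor_naturality f)
  pentagon W X Y Z := congr_arg (stab B).map (MonoidalCategory.pentagon _ _ _ _)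
  triangle X Y := congr_arg (stab B).map (MonoidalCategory.triangle _ _)

/-- The autoequivalence `Σ̲` of `K / add(B ⊗ K)` induced by the suspension of `K`. (It is in
general not the suspension of the triangulated category `K / add(B ⊗ K)`.) -/
def inducedShift [TensorTriangulated C] (B : C) : StableCat B ⥤ StableCat B :=
  CategoryTheory.Quotient.lift _ (shiftFunctor C (1 : ℤ) ⋙ stab B) (by
    rintro X Y f g ⟨P, hP, a, b, h⟩
    refine CategoryTheory.Quotient.sound _ ⟨_, hP.shift, a⟦1⟧', b⟦1⟧', ?_⟩
    rw [← Functor.map_comp, ← h, Functor.map_sub])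

/-- An object of a monoidal category is invertible if it has an inverse for `⊗`. -/
def IsTensorInvertible {D : Type u} [Category.{v} D] [MonoidalCategory D] (X : D) : Prop :=
  ∃ Y : D, Nonempty (X ⊗ Y ≅ 𝟙_ D) ∧ Nonempty (Y ⊗ X ≅ 𝟙_ D)

/-- The class `E_B` of `B`-split triangles: the distinguished triangles `X ⟶ Y ⟶ Z ⟶ ΣX` whose
third morphism is killed by `B ⊗ -`. -/
def IsBSplit (B : C) (T : Triangle C) : Prop :=
  T ∈ distTriang C ∧ B ◁ T.mor₃ = 0

/-- The object `I` is `E_B`-injective: for each `B`-split triangle `X ⟶ Y ⟶ Z ⟶ ΣX` the sequence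
`0 ⟶ K(Z, I) ⟶ K(Y, I) ⟶ K(X, I) ⟶ 0` is exact. -/
def IsRelInjective (B I : C) : Prop :=
  ∀ T : Triangle C, IsBSplit B T →
    Function.Injective (fun u : T.obj₃ ⟶ I => T.mor₂ ≫ u) ∧
    Function.Exact (fun u : T.obj₃ ⟶ I => T.mor₂ ≫ u) (fun u : T.obj₂ ⟶ I => T.mor₁ ≫ u) ∧
    Function.Surjective (fun u : T.obj₂ ⟶ I => T.mor₁ ≫ u)

/-- A choice, for each object `X`, of a `B`-split triangle `X ⟶ env X ⟶ cone X ⟶ ΣX` with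
`env X` an `E_B`-injective object, i.e. of an `E_B`-injective preenvelope of `X` with its cofibre. -/
structure Preenvelopes (B : C) where
  env : C → C
  cone : C → C
  ι (X : C) : X ⟶ env X
  p (X : C) : env X ⟶ cone X
  α (X : C) : cone X ⟶ X⟦(1 : ℤ)⟧
  split (X : C) : IsBSplit B (Triangle.mk (ι X) (p X) (α X))
  injective (X : C) : IsRelInjective B (env X)

section

variable {B : C}

lemma whisker_comm_zero {A D Z Z' : C} {h : Z ⟶ Z'} (H : (A ⊗ D : C) ◁ h = 0) :
    (D ⊗ A : C) ◁ h = 0 := by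
  have e := MonoidalCategory.whisker_exchange (β_ D A).hom h
  rw [H, comp_zero] at e
  exact (cancel_mono ((β_ D A).hom ▷ Z')).1 (by rw [e, zero_comp])

lemma whisker_tensor_zero {D Z Z' : C} (A : C) {h : Z ⟶ Z'} (H : D ◁ h = 0) :
    (A ⊗ D : C) ◁ h = 0 := by
  rw [MonoidalCategory.tensor_whiskerLeft, H]; simp

/-- The dual of `B` kills every morphism that is killed by `B`. -/
lemma dual_whisker_zero (Bd : C) [ExactPairing B Bd] {Z Z' : C} {h : Z ⟶ Z'}
    (H : B ◁ h = 0) : Bd ◁ h = 0 := by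
  have H' : ((Bd ⊗ B) ⊗ Bd : C) ◁ h = 0 :=
    whisker_comm_zero (whisker_tensor_zero _ (whisker_tensor_zero _ H))
  have t := ExactPairing.coevaluation_evaluation B Bd
  have e : Bd ◁ h = ((ρ_ Bd).inv ≫ Bd ◁ η_ B Bd ≫ (α_ _ _ _).inv ≫ ε_ B Bd ▷ Bd ≫
      (λ_ Bd).hom) ▷ Z ≫ Bd ◁ h := by
    rw [reassoc_of% t]; simp
  rw [e]
  simp only [MonoidalCategory.comp_whiskerRight, Category.assoc]
  rw [← MonoidalCategory.whisker_exchange, ← MonoidalCategory.whisker_exchange_assoc, reassoc_of% H']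
  simp

/-- Every morphism killed by `B` is killed by composition with the morphisms to the objects of
`add(B ⊗ K)`. -/
lemma AddTensor.comp_eq_zero (Bd : C) [ExactPairing B Bd] {P : C} (hP : AddTensor B P)
    {Z Z' : C} {h : Z ⟶ Z'} (H : B ◁ h = 0) (u : Z' ⟶ P) : h ≫ u = 0 := by
  obtain ⟨W, ⟨r⟩⟩ := hP.exists_retract
  have : h ≫ u ≫ r.i = 0 := by
    apply (tensorLeftHomEquiv Z B Bd W).symm.injective
    rw [tensorLeftHomEquiv_symm_naturality, dual_whisker_zero Bd H, zero_comp]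
    simp [tensorLeftHomEquiv]
  calc h ≫ u = (h ≫ u ≫ r.i) ≫ r.r := by simp
    _ = 0 := by rw [this, zero_comp]

lemma tensorShift_naturality [TensorTriangulated C] (A : C) {X Y : C} (f : X ⟶ Y) :
    A ◁ f⟦(1 : ℤ)⟧' ≫ (tensorShift A Y).hom = (tensorShift A X).hom ≫ (A ◁ f)⟦(1 : ℤ)⟧' := by
  simp only [tensorShift, Iso.trans_hom, Functor.mapIso_hom, Category.assoc,
    BraidedCategory.braiding_naturality_right_assoc,
    reassoc_of% (TensorTriangulated.naturality_left f A), ← Functor.map_comp,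
    BraidedCategory.braiding_naturality_left]

/-- The objects of `add(B ⊗ K)` are `E_B`-injective. -/
lemma AddTensor.isRelInjective [TensorTriangulated C] (Bd : C) [ExactPairing B Bd] {I : C}
    (hI : AddTensor B I) : IsRelInjective B I := by
  intro T hT
  refine ⟨fun u u' h => ?_, fun y => ⟨fun h => ?_, ?_⟩, fun u => ?_⟩
  · obtain ⟨v, hv⟩ := T.yoneda_exact₃ hT.1 (u - u') (by
      rw [Preadditive.comp_sub, sub_eq_zero]; exact h)
    rw [hI.comp_eq_zero Bd hT.2, sub_eq_zero] at hv
    exact hv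
  · obtain ⟨v, hv⟩ := T.yoneda_exact₂ hT.1 y h
    exact ⟨v, hv.symm⟩
  · rintro ⟨v, rfl⟩
    simp [reassoc_of% (comp_distTriang_mor_zero₁₂ T hT.1)]
  · obtain ⟨b, hb, -⟩ := complete_distinguished_triangle_morphism₂ T _ hT.1
      (contractible_distinguished I) u 0 
        ((hI.shift.comp_eq_zero Bd hT.2 (u⟦(1 : ℤ)⟧')).trans zero_comp.symm)
    exact ⟨b, hb.trans (Category.comp_id u)⟩

/-- The morphism `coev ⊗ X : X ⟶ B ⊗ (Bᵛ ⊗ X)`. -/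
def coevAt (B Bd : C) [ExactPairing B Bd] (X : C) : X ⟶ (B ⊗ (Bd ⊗ X) : C) :=
  (λ_ X).inv ≫ η_ B Bd ▷ X ≫ (α_ B Bd X).hom

lemma whisker_coevAt (Bd : C) [ExactPairing B Bd] (X : C) :
    ∃ r : (B ⊗ (B ⊗ (Bd ⊗ X)) : C) ⟶ (B ⊗ X : C), B ◁ coevAt B Bd X ≫ r = 𝟙 _ := by
  refine ⟨B ◁ (α_ B Bd X).inv ≫ (α_ B (B ⊗ Bd) X).inv ≫
    ((β_ B (B ⊗ Bd)).hom ≫ (α_ B Bd B).hom ≫ B ◁ ε_ B Bd ≫ (ρ_ B).hom) ▷ X, ?_⟩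
  have e : B ◁ η_ B Bd ≫ (β_ B (B ⊗ Bd)).hom ≫ (α_ B Bd B).hom ≫ B ◁ ε_ B Bd ≫ (ρ_ B).hom =
      (ρ_ B).hom := by
    rw [BraidedCategory.braiding_naturality_right_assoc,
      reassoc_of% (ExactPairing.evaluation_coevaluation B Bd)]
    simp
  have e' := congr_arg (fun f => f ▷ X) e
  simp only [MonoidalCategory.comp_whiskerRight] at e'
  simp only [coevAt, MonoidalCategory.whiskerLeft_comp, MonoidalCategory.comp_whiskerRight,
    Category.assoc, MonoidalCategory.whiskerLeft_hom_inv_assoc]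
  rw [MonoidalCategory.associator_inv_naturality_middle_assoc, e']
  simp

lemma isBSplit_coevAt [TensorTriangulated C] (Bd : C) [ExactPairing B Bd] {X Z : C}
    {g : (B ⊗ (Bd ⊗ X) : C) ⟶ Z} {h : Z ⟶ X⟦(1 : ℤ)⟧}
    (hT : Triangle.mk (coevAt B Bd X) g h ∈ distTriang C) :
    IsBSplit B (Triangle.mk (coevAt B Bd X) g h) := by
  refine ⟨hT, ?_⟩
  obtain ⟨r, hr⟩ := whisker_coevAt (B := B) Bd X
  have e : h ≫ (coevAt B Bd X)⟦(1 : ℤ)⟧' = 0 := comp_distTriang_mor_zero₃₁ _ hT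
  have e' := congr_arg (fun f => B ◁ f ≫ (tensorShift B _).hom ≫ r⟦(1 : ℤ)⟧') e
  simp only [MonoidalCategory.whiskerLeft_comp, Category.assoc,
    reassoc_of% (tensorShift_naturality B (coevAt B Bd X)), ← Functor.map_comp, hr,
    MonoidalPreadditive.whiskerLeft_zero, zero_comp] at e'
  rw [CategoryTheory.Functor.map_id, Category.comp_id] at e'
  exact (cancel_mono (tensorShift B X).hom).1 (e'.trans zero_comp.symm)

/-- The `E_B`-injective objects belong to `add(B ⊗ K)`. -/
lemma IsRelInjective.addTensor [TensorTriangulated C] (Bd : C) [ExactPairing B Bd] {I : C}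
    (hI : IsRelInjective B I) : AddTensor B I := by
  obtain ⟨Z, g, h, hT⟩ := distinguished_cocone_triangle (coevAt B Bd I)
  obtain ⟨r, hr⟩ := (hI _ (isBSplit_coevAt Bd hT)).2.2 (𝟙 I)
  exact .of_retract ⟨_, r, hr⟩

/-- There are enough `E_B`-injectives. -/
lemma Preenvelopes.nonempty [TensorTriangulated C] (B Bd : C) [ExactPairing B Bd] :
    Nonempty (Preenvelopes B) := by
  choose Z g h hT using fun X : C => distinguished_cocone_triangle (coevAt B Bd X)
  exact ⟨⟨_, Z, _, g, h, fun X => isBSplit_coevAt Bd (hT X),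
    fun X => AddTensor.isRelInjective Bd (.of ⟨_, rfl⟩)⟩⟩

namespace Preenvelopes

variable (S : Preenvelopes B)

/-- A morphism `f : X ⟶ Y` extends to a morphism between the chosen triangles of `X` and `Y`. -/
lemma exists_lift {X Y : C} (f : X ⟶ Y) : ∃ (f' : S.cone X ⟶ S.cone Y) (e : S.env X ⟶ S.env Y),
    S.ι X ≫ e = f ≫ S.ι Y ∧ S.p X ≫ f' = e ≫ S.p Y ∧ S.α X ≫ f⟦(1 : ℤ)⟧' = f' ≫ S.α Y := by
  obtain ⟨e, he⟩ := (S.injective Y _ (S.split X)).2.2 (f ≫ S.ι Y)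
  obtain ⟨f', h₁, h₂⟩ := complete_distinguished_triangle_morphism _ _ (S.split X).1 (S.split Y).1
    f e he
  exact ⟨f', e, he, h₁, h₂⟩

/-- A morphism `f' : cone X ⟶ cone Y` which is part of a morphism of triangles extending `f`. -/
noncomputable def lift {X Y : C} (f : X ⟶ Y) : S.cone X ⟶ S.cone Y := (S.exists_lift f).choose

lemma lift_α {X Y : C} (f : X ⟶ Y) : S.α X ≫ f⟦(1 : ℤ)⟧' = S.lift f ≫ S.α Y :=
  (S.exists_lift f).choose_spec.choose_spec.2.2

/-- The class of `lift f` in `K / add(B ⊗ K)` depends only on the class of `f`, and it is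
determined by compatibility with the third morphisms of the triangles. -/
lemma lift_unique [TensorTriangulated C] (Bd : C) [ExactPairing B Bd] {X Y : C} {f g : X ⟶ Y}
    (h : stableRel B f g) {f' g' : S.cone X ⟶ S.cone Y}
    (hf : S.α X ≫ f⟦(1 : ℤ)⟧' = f' ≫ S.α Y) (hg : S.α X ≫ g⟦(1 : ℤ)⟧' = g' ≫ S.α Y) :
    stableRel B f' g' := by
  obtain ⟨P, hP, a, b, h⟩ := h
  obtain ⟨w, hw⟩ := Triangle.coyoneda_exact₃ _ (S.split Y).1 (f' - g') (by
    change (f' - g') ≫ S.α Y = 0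
    have : S.α X ≫ a⟦(1 : ℤ)⟧' = 0 := hP.shift.comp_eq_zero Bd (S.split X).2 (a⟦1⟧')
    rw [Preadditive.sub_comp, ← hf, ← hg, ← Preadditive.comp_sub, ← Functor.map_sub, h,
      Functor.map_comp, reassoc_of% this, zero_comp])
  exact ⟨_, (S.injective Y).addTensor Bd, w, S.p Y, hw⟩

/-- The suspension `Σ_B` of `K / add(B ⊗ K)`: it sends `X` to the cofibre of the chosen
preenvelope of `X`, and the class of `f` to the class of a morphism `f'` which is part of a
morphism of triangles extending `f`. -/
noncomputable def suspension [TensorTriangulated C] (Bd : C) [ExactPairing B Bd] :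
    StableCat B ⥤ StableCat B :=
  CategoryTheory.Quotient.lift _
    { obj := fun X => (stab B).obj (S.cone X)
      map := fun f => (stab B).map (S.lift f)
      map_id := fun X => by
        refine Eq.trans ?_ ((stab B).map_id (S.cone X))
        exact CategoryTheory.Quotient.sound _ (S.lift_unique Bd
          (Congruence.equivalence.refl (𝟙 X)) (S.lift_α _) (by simp))
      map_comp := fun f g => by
        rw [← Functor.map_comp]
        exact CategoryTheory.Quotient.sound _ (S.lift_unique Bd
          (Congruence.equivalence.refl (f ≫ g)) (S.lift_α _) (by
            rw [Functor.map_comp, Category.assoc, ← S.lift_α, reassoc_of% (S.lift_α f)])) }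
    (fun _ _ f g h => CategoryTheory.Quotient.sound _
      (S.lift_unique Bd h (S.lift_α f) (S.lift_α g)))

/-- The comparison morphism `Σ_B ⟶ Σ̲`, whose component at `X` is the class of the third morphism
`cone X ⟶ ΣX` of the chosen triangle. -/
noncomputable def comparison [TensorTriangulated C] (Bd : C) [ExactPairing B Bd] :
    S.suspension Bd ⟶ inducedShift B where
  app X := (stab B).map (S.α X.as)
  naturality := by
    rintro X Y ⟨f⟩
    exact congr_arg (stab B).map (S.lift_α f).symm

end Preenvelopes

/-- The square with sides `i : X ⟶ X'`, `f : X ⟶ Y`, `k : X' ⟶ Z`, `g : Y ⟶ Z` is homotopy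
bicartesian: it is part of a distinguished triangle `X ⟶ X' ⊞ Y ⟶ Z ⟶ ΣX`. -/
def IsHomotopyBicartesian {X X' Y Z : C} (i : X ⟶ X') (f : X ⟶ Y) (k : X' ⟶ Z) (g : Y ⟶ Z) :
    Prop :=
  ∃ δ : Z ⟶ X⟦(1 : ℤ)⟧, Triangle.mk (biprod.lift i f) (biprod.desc k (-g)) δ ∈ distTriang C

/-- The diagram in `K` which defines a basic triangle `X ⟶ Y ⟶ Z ⟶ Σ_B X` in `K / add(B ⊗ K)`:
`Z` is the homotopy pushout of `f` along the preenvelope `X ⟶ env X`, and the morphism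
`h : Z ⟶ cone X` is obtained by completing this square to a morphism of distinguished triangles
from `X ⟶ env X ⟶ cone X ⟶ ΣX` to `Y ⟶ Z ⟶ cone X ⟶ ΣY` which is the identity on `cone X`. -/
def IsBasicTriangle (S : Preenvelopes B) {X Y Z : C} (f : X ⟶ Y) (g : Y ⟶ Z)
    (h : Z ⟶ S.cone X) : Prop :=
  ∃ k : S.env X ⟶ Z, IsHomotopyBicartesian (S.ι X) f k g ∧ k ≫ h = S.p X ∧
    Triangle.mk g h (S.α X ≫ f⟦(1 : ℤ)⟧') ∈ distTriang C

/-- The distinguished triangles `X ⟶ Y ⟶ Z ⟶ Σ_B X` of `K / add(B ⊗ K)`: those isomorphic to the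
image of a basic one. -/
def IsStableDistinguished [TensorTriangulated C] (Bd : C) [ExactPairing B Bd]
    (S : Preenvelopes B) {X Y Z : StableCat B} (u : X ⟶ Y) (v : Y ⟶ Z)
    (w : Z ⟶ (S.suspension Bd).obj X) : Prop :=
  ∃ (X' Y' Z' : C) (f : X' ⟶ Y') (g : Y' ⟶ Z') (h : Z' ⟶ S.cone X'), IsBasicTriangle S f g h ∧
    ∃ (a : X ≅ (stab B).obj X') (b : Y ≅ (stab B).obj Y') (c : Z ≅ (stab B).obj Z'),
      u ≫ b.hom = a.hom ≫ (stab B).map f ∧ v ≫ c.hom = b.hom ≫ (stab B).map g ∧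
        w ≫ (S.suspension Bd).map a.hom = c.hom ≫ (stab B).map h

/-- The identification of `π(Σ(F ⊗ X))` with `π(F) ⊗ Σ̲ π(X)`, the class of the isomorphism
`Σ(F ⊗ X) ≅ F ⊗ ΣX` of `K`. -/
def shiftTensorIso [TensorTriangulated C] (B F X : C) :
    (stab B).obj ((F ⊗ X : C)⟦(1 : ℤ)⟧) ≅
      (inducedShift B ⋙ tensorLeft ((stab B).obj F)).obj ((stab B).obj X) :=
  (stab B).mapIso (tensorShift F X).symm

end

end

end RelStable

/-! Everything rests on one uniqueness principle. By duality, a morphism killed by `B ⊗ -` vanishes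
after composition with any morphism to an object of add(B ⊗ K) (`AddTensor.comp_eq_zero`). Let β : Q
⟶ W be killed by `B ⊗ -`, with fibre P in add(B ⊗ K) (`IsUniversalPhantom`). The obstruction to
lifting a killed morphism along β is a composite to ΣP, hence zero, and two lifts differ by a
morphism through P. So W alone determines π(Q), together with its map to π(W), up to isomorphism
(`IsUniversalPhantom.isIso_stab_map`).

The three statements compare universal phantoms. Over the cofibre G of the evaluation, both 𝟙 ⟶ G
and ξ ⊗ G qualify, so π(F ⊗ G) ≅ 𝟙, which is (a). Over ΣX, both `S.α X` and ξ ⊗ ΣX qualify; the lift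
of the former along the latter induces φ, and the lifting equation is (b)
(`Preenvelopes.exists_suspension_iso`).

For (c), the third object of a basic triangle on f is a homotopy pullback of `S.α X` along cone(f) ⟶
ΣX. The principle persists for such pullbacks (`IsUniversalPhantom.exists_iso_of_distinguished`), so
any universal phantom over ΣX computes the cone of π(f). Taking Σ(ξ ⊗ X) and rotating the given
triangle yields (c); the rotation produces the sign. -/

namespace RelStable

/-! ### Distinguished triangles and homotopy pushouts -/

section Triangles

variable {C : Type u} [Category.{v} C] [HasZeroObject C] [HasShift C ℤ]
    [Preadditive C] [∀ n : ℤ, (shiftFunctor C n).Additive] [Pretriangulated C]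

section Exactness

variable {X Y Z V : C} {f : X ⟶ Y} {g : Y ⟶ Z} {h : Z ⟶ X⟦(1 : ℤ)⟧}

lemma distinguished_of_iso (hT : Triangle.mk f g h ∈ distTriang C) {X' Y' Z' : C}
    {f' : X' ⟶ Y'} {g' : Y' ⟶ Z'} {h' : Z' ⟶ X'⟦(1 : ℤ)⟧} (a : X' ≅ X) (b : Y' ≅ Y) (c : Z' ≅ Z)
    (hf : f' ≫ b.hom = a.hom ≫ f) (hg : g' ≫ c.hom = b.hom ≫ g)
    (hh : h' ≫ a.hom⟦(1 : ℤ)⟧' = c.hom ≫ h) : Triangle.mk f' g' h' ∈ distTriang C :=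
  isomorphic_distinguished _ hT _ (Triangle.isoMk _ _ a b c hf hg hh)

lemma exists_lift₁ (hT : Triangle.mk f g h ∈ distTriang C) (u : V ⟶ Y) (hu : u ≫ g = 0) :
    ∃ t : V ⟶ X, u = t ≫ f :=
  Triangle.coyoneda_exact₂ _ hT u hu

lemma exists_lift₂ (hT : Triangle.mk f g h ∈ distTriang C) (u : V ⟶ Z) (hu : u ≫ h = 0) :
    ∃ t : V ⟶ Y, u = t ≫ g :=
  Triangle.coyoneda_exact₃ _ hT u hu

lemma exists_desc₃ (hT : Triangle.mk f g h ∈ distTriang C) (u : Z ⟶ V) (hu : g ≫ u = 0) :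
    ∃ t : X⟦(1 : ℤ)⟧ ⟶ V, u = h ≫ t :=
  Triangle.yoneda_exact₃ _ hT u hu

lemma distinguished_neg₂₃ (hT : Triangle.mk f g h ∈ distTriang C) :
    Triangle.mk f (-g) (-h) ∈ distTriang C :=
  distinguished_of_iso hT (Iso.refl X) (Iso.refl Y) ⟨-𝟙 Z, -𝟙 Z, by simp, by simp⟩
    (by simp) (by simp) (by simp)

lemma distinguished_rotate_inv (hT : Triangle.mk g h (f⟦(1 : ℤ)⟧') ∈ distTriang C) :
    Triangle.mk f (-g) h ∈ distTriang C := by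
  rw [rotate_distinguished_triangle]
  change Triangle.mk (-g) h (-f⟦(1 : ℤ)⟧') ∈ distTriang C
  exact distinguished_of_iso hT ⟨-𝟙 Y, -𝟙 Y, by simp, by simp⟩ (Iso.refl _) (Iso.refl _) (by simp) (by simp) (by simp)

/-- The rotation of a distinguished triangle, with the sign on the second morphism. -/
lemma distinguished_rotate_neg (hT : Triangle.mk f g h ∈ distTriang C) :
    Triangle.mk g (-h) (f⟦(1 : ℤ)⟧') ∈ distTriang C := by
  have := distinguished_neg₂₃ (rot_of_distTriang _ hT)
  rwa [neg_neg] at this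

end Exactness

lemma distinguished_fst (X Y : C) :
    Triangle.mk (biprod.fst : X ⊞ Y ⟶ X) (0 : X ⟶ Y⟦(1 : ℤ)⟧)
      (-(biprod.inr : Y ⟶ X ⊞ Y)⟦(1 : ℤ)⟧') ∈ distTriang C := by
  have h : Triangle.mk (biprod.snd : Y ⊞ X ⟶ X) (0 : X ⟶ Y⟦(1 : ℤ)⟧)
      (-(biprod.inl : Y ⟶ Y ⊞ X)⟦(1 : ℤ)⟧') ∈ distTriang C :=
    rot_of_distTriang _ (binaryBiproductTriangle_distinguished Y X)
  have e : (biprod.inr : Y ⟶ X ⊞ Y) ≫ (biprod.braiding X Y).hom = biprod.inl := by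
    apply biprod.hom_ext <;> simp
  exact distinguished_of_iso h (biprod.braiding X Y) (Iso.refl X) (Iso.refl _) (by simp) (by simp)
    (by rw [Preadditive.neg_comp, ← Functor.map_comp, e]; simp)

/-- The homotopy pushout of a distinguished triangle along a morphism out of its first object. -/
lemma exists_homotopyPushout [IsTriangulated C] {X E D Y : C} {i : X ⟶ E} {p : E ⟶ D}
    {a : D ⟶ X⟦(1 : ℤ)⟧} (hT : Triangle.mk i p a ∈ distTriang C) (f : X ⟶ Y) :
    ∃ (Z : C) (k : E ⟶ Z) (g : Y ⟶ Z) (h : Z ⟶ D), IsHomotopyBicartesian i f k g ∧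
      k ≫ h = p ∧ Triangle.mk g h (a ≫ f⟦(1 : ℤ)⟧') ∈ distTriang C := by
  obtain ⟨Z, v, w, h₁₂⟩ := distinguished_cocone_triangle (biprod.lift i f)
  -- The octahedron on i = fst ∘ (i, f): the cones of the factors are Z and ΣY, and that of the
  -- composite is D.
  let o := (IsTriangulated.octahedron_axiom (biprod.lift_fst i f) h₁₂
    (distinguished_fst E Y) hT).some
  have e₁ : v = biprod.desc (biprod.inl ≫ v) (-(-(biprod.inr ≫ v))) := by
    apply biprod.hom_ext' <;> simp
  refine ⟨Z, biprod.inl ≫ v, -(biprod.inr ≫ v), o.m₁, ⟨w, e₁ ▸ h₁₂⟩, ?_, ?_⟩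
  · rw [Category.assoc, o.comm₁, biprod.inl_fst_assoc]
  -- Projecting the octahedral relation to ΣY identifies the connecting morphism; its sign cancels
  -- the one built into g.
  · have e₂ : o.m₃ = -(a ≫ f⟦(1 : ℤ)⟧') := by
      have e := congr_arg (fun t => t ≫ (biprod.snd : E ⊞ Y ⟶ Y)⟦(1 : ℤ)⟧') o.comm₄
      simp only [Category.assoc, Preadditive.neg_comp, Preadditive.comp_neg,
        ← Functor.map_comp, biprod.lift_snd, biprod.inr_snd, CategoryTheory.Functor.map_id,
        Category.comp_id] at e
      rw [e, neg_neg]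
    have e₃ := distinguished_neg₂₃ o.mem
    rw [rotate_distinguished_triangle]
    change Triangle.mk o.m₁ (a ≫ f⟦(1 : ℤ)⟧') (-(-(biprod.inr ≫ v))⟦(1 : ℤ)⟧') ∈ distTriang C
    simpa [e₂] using e₃

end Triangles

variable {C : Type u} [Category.{v} C] [HasZeroObject C] [HasShift C ℤ]
    [Preadditive C] [∀ n : ℤ, (shiftFunctor C n).Additive] [Pretriangulated C]
    [MonoidalCategory C] [SymmetricCategory C] [MonoidalPreadditive C]

/-! ### The quotient functor, morphisms killed by B, and shifts -/

lemma stab_map_eq_of_comp_factors {B X Y P : C} {f g : X ⟶ Y} (hP : AddTensor B P) (a : X ⟶ P)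
    (b : P ⟶ Y) (h : f - g = a ≫ b) : (stab B).map f = (stab B).map g :=
  CategoryTheory.Quotient.sound _ ⟨P, hP, a, b, h⟩

lemma stab_map_neg (B : C) {X Y : C} (f : X ⟶ Y) : (stab B).map (-f) = -(stab B).map f := rfl

lemma AddTensor.self (B : C) : AddTensor B B := .of_retract (Retract.ofIso (ρ_ B).symm)

lemma whiskerLeft_comp_eq_zero_right {B X Y Z : C} {f : X ⟶ Y} (hf : B ◁ f = 0) (g : Y ⟶ Z) :
    B ◁ (f ≫ g) = 0 := by
  rw [MonoidalCategory.whiskerLeft_comp, hf, zero_comp]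

lemma whiskerLeft_comp_eq_zero_left {B X Y Z : C} (f : X ⟶ Y) {g : Y ⟶ Z} (hg : B ◁ g = 0) :
    B ◁ (f ≫ g) = 0 := by
  rw [MonoidalCategory.whiskerLeft_comp, hg, comp_zero]

/-- If `B ⊗ f` has a section and `f ≫ g = 0`, then `B ⊗ g = 0`. -/
lemma whiskerLeft_eq_zero_of_section {B X Y Z : C} {f : X ⟶ Y} {g : Y ⟶ Z} (h : f ≫ g = 0)
    (s : (B ⊗ Y : C) ⟶ B ⊗ X) (hs : s ≫ B ◁ f = 𝟙 _) : B ◁ g = 0 := by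
  rw [← Category.id_comp (B ◁ g), ← hs, Category.assoc, ← MonoidalCategory.whiskerLeft_comp, h]
  simp

/-- If `B ⊗ g` has a retraction and `f ≫ g = 0`, then `B ⊗ f = 0`. -/
lemma whiskerLeft_eq_zero_of_retraction {B X Y Z : C} {f : X ⟶ Y} {g : Y ⟶ Z} (h : f ≫ g = 0)
    (r : (B ⊗ Z : C) ⟶ B ⊗ Y) (hr : B ◁ g ≫ r = 𝟙 _) : B ◁ f = 0 := by
  rw [← Category.comp_id (B ◁ f), ← hr, ← MonoidalCategory.whiskerLeft_comp_assoc, h]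
  simp

variable [TensorTriangulated C]

/-- Writing W as Σ(Σ⁻¹W) and moving Σ out of the tensor product gives Σ⁻¹(B ⊗ W) ≅ B ⊗ Σ⁻¹W. -/
lemma AddTensor.shift_neg {B P : C} (h : AddTensor B P) : AddTensor B (P⟦(-1 : ℤ)⟧) := by
  obtain ⟨W, ⟨r⟩⟩ := h.exists_retract
  refine .of_retract (W := W⟦(-1 : ℤ)⟧) ((r.map (shiftFunctor C (-1 : ℤ))).trans
    (Retract.ofIso ?_))
  exact (shiftFunctor C (-1 : ℤ)).mapIso ((tensorLeft B).mapIso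
    ((shiftEquiv C (1 : ℤ)).counitIso.app W).symm ≪≫ tensorShift B _) ≪≫
    ((shiftEquiv C (1 : ℤ)).unitIso.app _).symm

lemma tensorShift_unit (X : C) :
    (tensorShift (𝟙_ C) X).hom ≫ (λ_ X).hom⟦(1 : ℤ)⟧' = (λ_ (X⟦(1 : ℤ)⟧)).hom := by
  simp only [tensorShift, Iso.trans_hom, Functor.mapIso_hom, Category.assoc, ← Functor.map_comp,
    braiding_leftUnitor, TensorTriangulated.unit, braiding_rightUnitor]

lemma tensorShift_naturality_left {A A' : C} (f : A ⟶ A') (X : C) :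
    f ▷ X⟦(1 : ℤ)⟧ ≫ (tensorShift A' X).hom = (tensorShift A X).hom ≫ (f ▷ X)⟦(1 : ℤ)⟧' := by
  simp only [tensorShift, Iso.trans_hom, Functor.mapIso_hom, Category.assoc,
    BraidedCategory.braiding_naturality_left_assoc,
    reassoc_of% (TensorTriangulated.naturality_right X f), ← Functor.map_comp,
    BraidedCategory.braiding_naturality_right]

/-! ### Universal phantoms: lifting and uniqueness -/

/-- A morphism `β : Q ⟶ W` killed by `B ⊗ -` whose fibre lies in `add(B ⊗ K)`. Every morphism to
`W` that is killed by `B ⊗ -` factors through `β`, uniquely up to morphisms factoring via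
`add(B ⊗ K)`. -/
structure IsUniversalPhantom (B : C) {Q W : C} (β : Q ⟶ W) : Prop where
  whisker_eq_zero : B ◁ β = 0
  exists_triangle : ∃ (P : C) (_ : AddTensor B P) (a : P ⟶ Q) (c : W ⟶ P⟦(1 : ℤ)⟧),
    Triangle.mk a β c ∈ distTriang C

namespace IsUniversalPhantom

variable {B Q W : C} {β : Q ⟶ W}

lemma exists_lift (hβ : IsUniversalPhantom B β) (Bd : C) [ExactPairing B Bd] {V : C} {u : V ⟶ W}
    (hu : B ◁ u = 0) : ∃ v : V ⟶ Q, v ≫ β = u := by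
  obtain ⟨P, hP, a, c, hT⟩ := hβ.exists_triangle
  obtain ⟨v, hv⟩ := exists_lift₂ hT u (hP.shift.comp_eq_zero Bd hu c)
  exact ⟨v, hv.symm⟩

lemma stab_map_eq (hβ : IsUniversalPhantom B β) {V : C} {u v : V ⟶ Q} (h : u ≫ β = v ≫ β) :
    (stab B).map u = (stab B).map v := by
  obtain ⟨P, hP, a, c, hT⟩ := hβ.exists_triangle
  obtain ⟨w, hw⟩ := exists_lift₁ hT (u - v) (by
    rw [Preadditive.sub_comp, h, sub_self])
  exact stab_map_eq_of_comp_factors hP w a hw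

/-- The inverse is a lift in the other direction; both composites are lifts of a universal phantom
along itself, hence identities in the quotient. -/
lemma isIso_stab_map (hβ : IsUniversalPhantom B β) (Bd : C) [ExactPairing B Bd] {Q' : C}
    {β' : Q' ⟶ W} (hβ' : IsUniversalPhantom B β') {v : Q ⟶ Q'} (hv : v ≫ β' = β) :
    IsIso ((stab B).map v) := by
  obtain ⟨w, hw⟩ := hβ.exists_lift Bd hβ'.whisker_eq_zero
  refine ⟨(stab B).map w, ?_, ?_⟩ <;> rw [← Functor.map_comp, ← CategoryTheory.Functor.map_id]
  · exact hβ.stab_map_eq (by simp [hv, hw])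
  · exact hβ'.stab_map_eq (by simp [hv, hw])

lemma comp_isos (hβ : IsUniversalPhantom B β) {Q' W' : C} (j : Q' ≅ Q) (i : W ≅ W') :
    IsUniversalPhantom B (j.hom ≫ β ≫ i.hom) := by
  obtain ⟨P, hP, a, c, hT⟩ := hβ.exists_triangle
  refine ⟨whiskerLeft_comp_eq_zero_left _ (whiskerLeft_comp_eq_zero_right hβ.whisker_eq_zero _),
    P, hP, a ≫ j.inv, i.inv ≫ c, distinguished_of_iso hT (Iso.refl _) j i.symm
      (by simp) (by simp) (by simp)⟩

lemma of_distinguished {X Y Z : C} {f : X ⟶ Y} {g : Y ⟶ Z} {h : Z ⟶ X⟦(1 : ℤ)⟧}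
    (hT : Triangle.mk f g h ∈ distTriang C) (hf : B ◁ f = 0) (hZ : AddTensor B Z) :
    IsUniversalPhantom B f :=
  ⟨hf, _, hZ.shift_neg, _, _, inv_rot_of_distTriang _ hT⟩

/-! ### Homotopy pullbacks of universal phantoms along cones -/

/-- A homotopy pullback `Z` of a universal phantom `β : Q ⟶ ΣX` along `cone f ⟶ ΣX`: its
comparison `γ` with the cone of `f` detects which morphisms factor via `add(B ⊗ K)`. -/
lemma stab_map_eq_of_comp_cone_eq {X Y Z D : C} {β : Q ⟶ X⟦(1 : ℤ)⟧}
    (hβ : IsUniversalPhantom B β) {f : X ⟶ Y} {g : Y ⟶ Z} {q : Z ⟶ Q}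
    (hT : Triangle.mk g q (β ≫ f⟦(1 : ℤ)⟧') ∈ distTriang C) {j : Y ⟶ D} {r : D ⟶ X⟦(1 : ℤ)⟧}
    (hD : Triangle.mk j r (f⟦(1 : ℤ)⟧') ∈ distTriang C) {γ : Z ⟶ D} (hg : g ≫ γ = j)
    (hq : q ≫ β = γ ≫ r) {V : C} {u v : V ⟶ Z} (h : u ≫ γ = v ≫ γ) :
    (stab B).map u = (stab B).map v := by
  obtain ⟨P, hP, a, c, hP'⟩ := hβ.exists_triangle
  have haβ : a ≫ β = 0 := comp_distTriang_mor_zero₁₂ _ hP'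
  have h₀ : (u - v) ≫ γ = 0 := by rw [Preadditive.sub_comp, h, sub_self]
  -- a lift of `a` to `Z` killed by `γ`
  obtain ⟨b, hb, hb'⟩ : ∃ b : P ⟶ Z, b ≫ q = a ∧ b ≫ γ = 0 := by
    obtain ⟨b, hb⟩ : ∃ b : P ⟶ Z, a = b ≫ q :=
      exists_lift₂ hT a (by simp [reassoc_of% haβ])
    obtain ⟨t, ht⟩ : ∃ t : P ⟶ Y, b ≫ γ = t ≫ j :=
      exists_lift₁ hD (b ≫ γ) (by simp [← hq, ← reassoc_of% hb, haβ])
    have hgq : g ≫ q = 0 := comp_distTriang_mor_zero₁₂ _ hT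
    -- Subtracting t ≫ g cancels b ≫ γ without changing b ≫ q.
    exact ⟨b - t ≫ g, by simp [Preadditive.sub_comp, hb, hgq],
      by simp [Preadditive.sub_comp, hg, ht]⟩
  obtain ⟨s, hs⟩ : ∃ s : V ⟶ P, (u - v) ≫ q = s ≫ a :=
    exists_lift₁ hP' _ (by rw [Category.assoc, hq, reassoc_of% h₀, zero_comp])
  obtain ⟨y, hy⟩ : ∃ y : V ⟶ Y, u - v - s ≫ b = y ≫ g :=
    exists_lift₁ hT _ (by
      rw [Preadditive.sub_comp, hs, Category.assoc, hb, sub_self])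
  have hyj : y ≫ j = 0 := by
    rw [← hg, ← Category.assoc, ← hy, Preadditive.sub_comp, h₀, Category.assoc, hb', comp_zero,
      sub_zero]
  obtain ⟨x, hx⟩ : ∃ x : V ⟶ X, y = x ≫ f :=
    exists_lift₁ (distinguished_rotate_inv hD) y (by simp [hyj])
  -- After subtracting s ≫ b, what remains of u - v is x ≫ f ≫ g. Since β kills Σ(f ≫ g), the latter
  -- factors through ΣP; desuspending makes f ≫ g factor through P.
  obtain ⟨t, t', ht⟩ : ∃ (t : P ⟶ Z) (t' : X ⟶ P), f ≫ g = t' ≫ t := by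
    obtain ⟨t, ht⟩ := exists_desc₃ hP' ((f ≫ g)⟦(1 : ℤ)⟧') (by
      rw [Functor.map_comp, ← Category.assoc]
      exact comp_distTriang_mor_zero₃₁ _ hT)
    refine ⟨(shiftFunctor C (1 : ℤ)).preimage t, (shiftFunctor C (1 : ℤ)).preimage c, ?_⟩
    apply (shiftFunctor C (1 : ℤ)).map_injective
    rw [ht, Functor.map_comp, Functor.map_preimage, Functor.map_preimage]
  refine stab_map_eq_of_comp_factors (.sum hP hP) (biprod.lift s (x ≫ t')) (biprod.desc b t) ?_
  rw [biprod.lift_desc, Category.assoc, ← ht, ← Category.assoc, ← hx, ← hy, add_sub_cancel]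

/-- The comparison of the homotopy pullbacks of two universal phantoms over `ΣX` along
`cone f ⟶ ΣX`. -/
lemma exists_iso_of_distinguished (Bd : C) [ExactPairing B Bd] {Q' X Y Z Z' : C}
    {β : Q ⟶ X⟦(1 : ℤ)⟧} {β' : Q' ⟶ X⟦(1 : ℤ)⟧}
    (hβ : IsUniversalPhantom B β) (hβ' : IsUniversalPhantom B β') {w : Q ⟶ Q'}
    (hw : w ≫ β' = β) {f : X ⟶ Y} {g : Y ⟶ Z} {q : Z ⟶ Q} {g' : Y ⟶ Z'} {q' : Z' ⟶ Q'}
    (hT : Triangle.mk g q (β ≫ f⟦(1 : ℤ)⟧') ∈ distTriang C)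
    (hT' : Triangle.mk g' q' (β' ≫ f⟦(1 : ℤ)⟧') ∈ distTriang C) :
    ∃ c : (stab B).obj Z ≅ (stab B).obj Z',
      (stab B).map g ≫ c.hom = (stab B).map g' ∧
        c.hom ≫ (stab B).map q' = (stab B).map q ≫ (stab B).map w := by
  -- D is a cone of f, shared by both pullbacks; each maps to it over ΣX and under Y.
  obtain ⟨D, j, r, hD⟩ := distinguished_cocone_triangle₂ (f⟦(1 : ℤ)⟧')
  have comparison {Q Z : C} {β : Q ⟶ X⟦(1 : ℤ)⟧} {g : Y ⟶ Z} {q : Z ⟶ Q}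
      (hT : Triangle.mk g q (β ≫ f⟦(1 : ℤ)⟧') ∈ distTriang C) :
      ∃ γ : Z ⟶ D, g ≫ γ = j ∧ q ≫ β = γ ≫ r := by
    obtain ⟨γ, h₁, h₂⟩ := complete_distinguished_triangle_morphism₂ _ _ hT hD (𝟙 Y) β
        (by change (β ≫ f⟦(1 : ℤ)⟧') ≫ (𝟙 Y)⟦(1 : ℤ)⟧' = β ≫ f⟦(1 : ℤ)⟧'; simp)
    exact ⟨γ, h₁.trans (Category.id_comp j), h₂⟩
  -- Existence half of the universal property of γ: lift u ≫ r along β, then to Z, and correct the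
  -- result by a morphism from Y.
  have lifting {Q Z : C} {β : Q ⟶ X⟦(1 : ℤ)⟧} (hβ : IsUniversalPhantom B β) {g : Y ⟶ Z}
      {q : Z ⟶ Q} (hT : Triangle.mk g q (β ≫ f⟦(1 : ℤ)⟧') ∈ distTriang C) {γ : Z ⟶ D}
      (hg : g ≫ γ = j) (hq : q ≫ β = γ ≫ r) {V : C} (u : V ⟶ D) (hu : B ◁ (u ≫ r) = 0) :
      ∃ v : V ⟶ Z, v ≫ γ = u := by
    have hr : r ≫ f⟦(1 : ℤ)⟧' = 0 := comp_distTriang_mor_zero₂₃ _ hD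
    obtain ⟨t, ht⟩ := hβ.exists_lift Bd hu
    obtain ⟨z, hz⟩ : ∃ z : V ⟶ Z, t = z ≫ q :=
      exists_lift₂ hT t (by simp [reassoc_of% ht, hr])
    obtain ⟨y, hy⟩ : ∃ y : V ⟶ Y, u - z ≫ γ = y ≫ j :=
      exists_lift₁ hD _ (by
        rw [Preadditive.sub_comp, Category.assoc, ← hq, ← ht, hz, Category.assoc, sub_self])
    exact ⟨z + y ≫ g, by rw [Preadditive.add_comp, Category.assoc, hg, ← hy, add_sub_cancel]⟩
  obtain ⟨γ, hg, hq⟩ := comparison hT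
  obtain ⟨γ', hg', hq'⟩ := comparison hT'
  obtain ⟨c, hc⟩ := lifting hβ' hT' hg' hq' γ (by
    rw [← hq]; exact whiskerLeft_comp_eq_zero_left _ hβ.whisker_eq_zero)
  obtain ⟨d, hd⟩ := lifting hβ hT hg hq γ' (by
    rw [← hq']; exact whiskerLeft_comp_eq_zero_left _ hβ'.whisker_eq_zero)
  -- c and d lift γ and γ' along each other, so uniqueness over D makes them mutually inverse; the
  -- same uniqueness gives compatibility with Y, and uniqueness over ΣX that with q and q'.
  refine ⟨⟨(stab B).map c, (stab B).map d, ?_, ?_⟩, ?_, ?_⟩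
  · rw [← Functor.map_comp, ← CategoryTheory.Functor.map_id]
    exact hβ.stab_map_eq_of_comp_cone_eq hT hD hg hq (by simp [hc, hd])
  · rw [← Functor.map_comp, ← CategoryTheory.Functor.map_id]
    exact hβ'.stab_map_eq_of_comp_cone_eq hT' hD hg' hq' (by simp [hc, hd])
  · rw [← Functor.map_comp]
    exact hβ'.stab_map_eq_of_comp_cone_eq hT' hD hg' hq' (by simp [hc, hg, hg'])
  · rw [← Functor.map_comp, ← Functor.map_comp]
    exact hβ'.stab_map_eq (by simp [hw, hq, hq', reassoc_of% hc])

end IsUniversalPhantom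

/-! ### The universal phantoms that occur -/

lemma Preenvelopes.isUniversalPhantom {B : C} (S : Preenvelopes B) (Bd : C) [ExactPairing B Bd]
    (X : C) : IsUniversalPhantom B (S.α X) :=
  ⟨(S.split X).2, S.env X, (S.injective X).addTensor Bd, _, _,
    rot_of_distTriang _ (S.split X).1⟩

/-- The morphism `ξ ⊗ W : F ⊗ W ⟶ W` is a universal phantom, where `ξ` is the fibre of the
coevaluation of `B`. -/
lemma isUniversalPhantom_whiskerRight {B Bd : C} [ExactPairing B Bd] {F : C} {ξ : F ⟶ 𝟙_ C}
    {δ : (B ⊗ Bd : C) ⟶ F⟦(1 : ℤ)⟧} (hF : Triangle.mk ξ (η_ B Bd) δ ∈ distTriang C) (W : C) :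
    IsUniversalPhantom B (ξ ▷ W ≫ (λ_ W).hom) := by
  obtain ⟨r, hr⟩ := whisker_coevAt (B := B) Bd W
  have hT : Triangle.mk (ξ ▷ W ≫ (λ_ W).hom) (coevAt B Bd W)
      ((α_ B Bd W).inv ≫ δ ▷ W ≫ (TensorTriangulated.shiftTensor F W).hom) ∈ distTriang C := by
    have hW : Triangle.mk (ξ ▷ W) (η_ B Bd ▷ W)
        (δ ▷ W ≫ (TensorTriangulated.shiftTensor F W).hom) ∈ distTriang C :=
      TensorTriangulated.distinguished _ hF W
    refine distinguished_of_iso hW (Iso.refl _) (λ_ W).symm (α_ B Bd W).symm ?_ ?_ ?_ <;>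
      simp [coevAt]
  -- A triangle identity provides the retraction r of B ⊗ coev, which forces B ⊗ (ξ ⊗ W) to vanish.
  refine .of_distinguished hT (whiskerLeft_eq_zero_of_retraction ?_ r hr) (.of ⟨_, rfl⟩)
  exact comp_distTriang_mor_zero₁₂ _ hT

/-- The cofibre `𝟙 ⟶ G` of the evaluation of `B` is a universal phantom. -/
lemma isUniversalPhantom_cofibre_evaluation {B Bd : C} [ExactPairing B Bd] {G : C} {g : 𝟙_ C ⟶ G}
    {h : G ⟶ (Bd ⊗ B : C)⟦(1 : ℤ)⟧} (hT : Triangle.mk (ε_ B Bd) g h ∈ distTriang C) :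
    IsUniversalPhantom B g := by
  refine ⟨whiskerLeft_eq_zero_of_section (f := ε_ B Bd) (comp_distTriang_mor_zero₁₂ _ hT)
    -- This is coev ⊗ B, a section of B ⊗ ev by the triangle identity.
    ((ρ_ B).hom ≫ (λ_ B).inv ≫ η_ B Bd ▷ B ≫ (α_ B Bd B).hom) ?_,
    _, (AddTensor.self B).tensor_left Bd, _, _, hT⟩
  simp only [Category.assoc, ExactPairing.evaluation_coevaluation]
  simp

/-! ### Invertibility, the suspension and basic triangles -/

lemma isTensorInvertible_stab_fibre {B Bd : C} [ExactPairing B Bd] {F : C} {ξ : F ⟶ 𝟙_ C}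
    {δ : (B ⊗ Bd : C) ⟶ F⟦(1 : ℤ)⟧} (hF : Triangle.mk ξ (η_ B Bd) δ ∈ distTriang C) :
    IsTensorInvertible ((stab B).obj F) := by
  obtain ⟨G, g, h, hT⟩ := distinguished_cocone_triangle (ε_ B Bd)
  have hg := isUniversalPhantom_cofibre_evaluation hT
  have hG := isUniversalPhantom_whiskerRight hF G
  -- Both morphisms are universal phantoms over G, so the lift F ⊗ G ⟶ 𝟙 is invertible in the
  -- quotient.
  obtain ⟨v, hv⟩ := hg.exists_lift Bd hG.whisker_eq_zero
  have := hG.isIso_stab_map Bd hg hv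
  let e : (stab B).obj (F ⊗ G) ≅ (stab B).obj (𝟙_ C) := asIso ((stab B).map v)
  exact ⟨(stab B).obj G, ⟨e⟩, ⟨(stab B).mapIso (β_ G F) ≪≫ e⟩⟩

/-- The suspension of `K / add(B ⊗ K)` is `F ⊗ Σ̲`, by an isomorphism which is compatible with the
morphisms to `Σ̲` at the level of `K`. -/
lemma Preenvelopes.exists_suspension_iso {B Bd : C} [ExactPairing B Bd] (S : Preenvelopes B)
    {F : C} {ξ : F ⟶ 𝟙_ C} {δ : (B ⊗ Bd : C) ⟶ F⟦(1 : ℤ)⟧}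
    (hF : Triangle.mk ξ (η_ B Bd) δ ∈ distTriang C) :
    ∃ φ : S.suspension Bd ≅ inducedShift B ⋙ tensorLeft ((stab B).obj F), ∀ X : C,
      ∃ v : S.cone X ⟶ F ⊗ X⟦(1 : ℤ)⟧, v ≫ ξ ▷ X⟦(1 : ℤ)⟧ ≫ (λ_ (X⟦(1 : ℤ)⟧)).hom = S.α X ∧
        φ.hom.app ((stab B).obj X) = (stab B).map v := by
  have hξ (X : C) := isUniversalPhantom_whiskerRight hF (X⟦(1 : ℤ)⟧)
  choose v hv using fun X : C =>
    (hξ X).exists_lift Bd (S.isUniversalPhantom Bd X).whisker_eq_zero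
  let e (X : C) : (stab B).obj (S.cone X) ≅ (stab B).obj (F ⊗ X⟦(1 : ℤ)⟧) :=
    have := (S.isUniversalPhantom Bd X).isIso_stab_map Bd (hξ X) (hv X)
    asIso ((stab B).map (v X))
  refine ⟨NatIso.ofComponents (fun X => e X.as) ?_, fun X => ⟨v X, hv X, rfl⟩⟩
  rintro ⟨X⟩ ⟨Y⟩ ⟨f⟩
  change (stab B).map (S.lift f) ≫ (stab B).map (v Y) =
    (stab B).map (v X) ≫ (stab B).map (F ◁ f⟦(1 : ℤ)⟧')
  rw [← Functor.map_comp, ← Functor.map_comp]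
  -- Naturality need only be checked after composing to ΣY, where it is naturality of `S.α`.
  refine (hξ Y).stab_map_eq ?_
  rw [Category.assoc, hv, ← S.lift_α, Category.assoc, MonoidalCategory.whisker_exchange_assoc,
    MonoidalCategory.leftUnitor_naturality, ← reassoc_of% (hv X)]

/-- Basic triangles can be computed by means of any universal phantom over `ΣX`. -/
lemma Preenvelopes.isStableDistinguished [IsTriangulated C] {B : C} (S : Preenvelopes B) (Bd : C)
    [ExactPairing B Bd] {Q X Y Z : C} {β : Q ⟶ X⟦(1 : ℤ)⟧} (hβ : IsUniversalPhantom B β)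
    {v : S.cone X ⟶ Q} (hv : v ≫ β = S.α X) {f : X ⟶ Y} {g : Y ⟶ Z} {q : Z ⟶ Q}
    (hT : Triangle.mk g q (β ≫ f⟦(1 : ℤ)⟧') ∈ distTriang C)
    (w : (stab B).obj Z ⟶ (stab B).obj (S.cone X))
    (hw : w ≫ (stab B).map v = (stab B).map q) :
    IsStableDistinguished Bd S ((stab B).map f) ((stab B).map g) w := by
  have hα := S.isUniversalPhantom Bd X
  obtain ⟨Z₀, k, g₀, h₀, hk, hp, hT₀⟩ := exists_homotopyPushout (S.split X).1 f
  obtain ⟨c, hc, hc'⟩ := hα.exists_iso_of_distinguished Bd hβ hv hT₀ hT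
  have := hα.isIso_stab_map Bd hβ hv
  refine ⟨X, Y, Z₀, f, g₀, h₀, ⟨k, hk, hp, hT₀⟩, Iso.refl _, Iso.refl _, c.symm, ?_, ?_, ?_⟩
  · exact (Category.comp_id _).trans (Category.id_comp _).symm
  · simp [← hc]
  -- As π(v) is invertible, the hypothesis on w determines it.
  · have e : w = c.inv ≫ (stab B).map h₀ := by
      rw [← cancel_mono ((stab B).map v), hw, Category.assoc, ← hc', Iso.inv_hom_id_assoc]
    refine Eq.trans ?_ e
    exact (congr_arg (w ≫ ·) ((S.suspension Bd).map_id _)).trans (Category.comp_id w)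

end RelStable

theorem mainTheorem4 {C : Type u} [Category.{v} C] [HasZeroObject C] [HasShift C ℤ]
    [Preadditive C] [∀ n : ℤ, (shiftFunctor C n).Additive] [Pretriangulated C] [IsTriangulated C]
    [MonoidalCategory C] [SymmetricCategory C] [MonoidalPreadditive C] [TensorTriangulated C]
    (B Bd : C) [ExactPairing B Bd]
    (F : C) (ξ : F ⟶ 𝟙_ C) (δ : (B ⊗ Bd : C) ⟶ F⟦(1 : ℤ)⟧)
    (hF : Triangle.mk ξ (η_ B Bd) δ ∈ distTriang C) :
    RelStable.IsTensorInvertible ((RelStable.stab B).obj F) ∧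
    ∀ S : RelStable.Preenvelopes B,
      ∃ φ : S.suspension Bd ≅
          RelStable.inducedShift B ⋙ tensorLeft ((RelStable.stab B).obj F),
        (∀ X : RelStable.StableCat B,
          φ.hom.app X ≫ ((RelStable.stab B).map ξ ▷ (RelStable.inducedShift B).obj X) ≫
              (λ_ ((RelStable.inducedShift B).obj X)).hom = (S.comparison Bd).app X) ∧
        ∀ {X Y Z : C} (f : X ⟶ Y) (g : Y ⟶ Z) (h : Z ⟶ (F ⊗ X : C)⟦(1 : ℤ)⟧),
          Triangle.mk ((ξ ⊗ₘ f) ≫ (λ_ Y).hom) g h ∈ distTriang C →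
          RelStable.IsStableDistinguished Bd S
            ((RelStable.stab B).map f) ((RelStable.stab B).map g)
            (-((RelStable.stab B).map h ≫ (RelStable.shiftTensorIso B F X).hom ≫
              φ.inv.app ((RelStable.stab B).obj X))) := by
  
  refine ⟨RelStable.isTensorInvertible_stab_fibre hF, fun S => ?_⟩
  obtain ⟨φ, hφ⟩ := S.exists_suspension_iso hF
  refine ⟨φ, fun ⟨X⟩ => ?_, fun {X Y Z} f g h hT => ?_⟩
  -- Statement (b) is the image under π of the lifting equation for v.
  · obtain ⟨v, hv, hφv⟩ := hφ X
    refine (congr_arg (· ≫ _) hφv).trans (Eq.trans ?_ (congr_arg (RelStable.stab B).map hv))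
    simp only [Functor.map_comp]
    rfl
  · obtain ⟨v, hv, hφv⟩ := hφ X
    have e : (RelStable.tensorShift F X).hom ≫ (ξ ▷ X ≫ (λ_ X).hom)⟦(1 : ℤ)⟧' =
        ξ ▷ X⟦(1 : ℤ)⟧ ≫ (λ_ (X⟦(1 : ℤ)⟧)).hom := by
      rw [Functor.map_comp, ← reassoc_of% (RelStable.tensorShift_naturality_left ξ X),
        RelStable.tensorShift_unit]
    -- Σ(ξ ⊗ X) is ξ ⊗ ΣX transported along Σ(F ⊗ X) ≅ F ⊗ ΣX.
    have hβ : RelStable.IsUniversalPhantom B ((ξ ▷ X ≫ (λ_ X).hom)⟦(1 : ℤ)⟧') := by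
      have := (RelStable.isUniversalPhantom_whiskerRight hF (X⟦(1 : ℤ)⟧)).comp_isos
        (RelStable.tensorShift F X).symm (Iso.refl _)
      rwa [← e, Iso.refl_hom, Category.comp_id, Iso.symm_hom, Iso.inv_hom_id_assoc] at this
    have hf : (ξ ⊗ₘ f) ≫ (λ_ Y).hom = (ξ ▷ X ≫ (λ_ X).hom) ≫ f := by
      simp [MonoidalCategory.tensorHom_def]
    -- Rotation with third morphism exactly Σ(ξ ⊗ f) puts the sign on h; this is the sign in (c).
    have hT' := RelStable.distinguished_rotate_neg hT
    rw [hf, Functor.map_comp] at hT'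
    -- The component of φ⁻¹ as a morphism between images of `stab`, where it is an inverse of π(v).
    obtain ⟨ψ, hψ, hψv⟩ : ∃ ψ : (RelStable.stab B).obj (F ⊗ X⟦(1 : ℤ)⟧) ⟶
        (RelStable.stab B).obj (S.cone X), φ.inv.app ((RelStable.stab B).obj X) = ψ ∧
          ψ ≫ (RelStable.stab B).map v = 𝟙 _ :=
      ⟨_, rfl, (congr_arg (_ ≫ ·) hφv.symm).trans (φ.inv_hom_id_app _)⟩
    rw [hψ]
    refine S.isStableDistinguished Bd hβ (v := v ≫ (RelStable.tensorShift F X).hom)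
      (by rw [Category.assoc, e, hv]) hT' (-((RelStable.stab B).map h ≫
        (RelStable.stab B).map (RelStable.tensorShift F X).inv ≫ ψ)) ?_
    rw [Preadditive.neg_comp, RelStable.stab_map_neg, Functor.map_comp, Category.assoc,
      Category.assoc, reassoc_of% hψv, ← Functor.map_comp, Iso.inv_hom_id,
      CategoryTheory.Functor.map_id, Category.comp_id]
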